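/- Let $H(\mathbb{C})$ be the space of entire functions with the topology of local uniform convergence, and for $a\in\mathbb{C}$ let $T_a:H(\mathbb{C})\to H(\mathbb{C})$ be the translation operator $T_a(f)(z)=f(z+a)$. For a sequence $(T_n)$ of continuous linear operators on $H(\mathbb{C})$, let $HC(\{T_n\})$ be the set of all $f\in H(\mathbb{C})$ such that $\{T_n f : n\ge 1\}$ is dense in $H(\mathbb{C})$ (the hypercyclic vectors of $(T_n)$). Let $(\lambda_n)_{n\ge 1}$ be a sequence of non-zero complex numbers with $|\lambda_n|\to+\infty$ such that for every $M>0$ there is a subsequence $(\mu_n)$ of $(\lambda_n)$ satisfying (i) $|\mu_{n+1}|-|\mu_n|>M$ for every $n\ge 1$, and (ii) $\sum_{n=1}^{\infty}\frac{1}{|\mu_n|}=+\infty$. Let $r_0,R_0,\theta_0,\theta_T$ be real numbers with $0<r_0<1<R_0<+\infty$, $0\le\theta_0<\theta_T\le 1$ and $\theta_T-\theta_0=\frac14$, and let $$S=\{re^{2\pi i t} : r\in[r_0,R_0],\ t\in[\theta_0,\theta_T]\}.$$ Then $\bigcap_{a\in S}HC(\{T_{\lambda_n a}\})$ is a $G_\delta$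 and dense subset of $H(\mathbb{C})$. -/

import Mathlib

open Filter Topology

/-- The space `H(ℂ)` of entire functions, as a subspace of the space `C(ℂ, ℂ)` of continuous
functions. The latter carries the compact-open topology, so `H(ℂ)` has the topology of uniform
convergence on compact sets, which is the topology of local uniform convergence. -/
def entireFunctions : Submodule ℂ C(ℂ, ℂ) where
  carrier := {f | Differentiable ℂ (f : ℂ → ℂ)}
  add_mem' hf hg := Differentiable.add hf hg
  zero_mem' := differentiable_const (0 : ℂ)
  smul_mem' c _ hf := Differentiable.const_smul hf c

/-- The translation operator `T_a : H(ℂ) → H(ℂ)`, `(T_a f)(z) = f (z + a)`, a continuous linear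
operator. -/
noncomputable def translation (a : ℂ) : entireFunctions →L[ℂ] entireFunctions where
  toFun f := ⟨(f : C(ℂ, ℂ)).comp ⟨fun z => z + a, by fun_prop⟩,
    Differentiable.comp (g := (f : C(ℂ, ℂ))) f.2 (differentiable_id.add_const a)⟩
  map_add' _ _ := rfl
  map_smul' _ _ := rfl
  cont := ((ContinuousMap.continuous_precomp _).comp continuous_subtype_val).subtype_mk _

@[simp]
theorem translation_apply (a : ℂ) (f : entireFunctions) (z : ℂ) :
    (translation a f : C(ℂ, ℂ)) z = (f : C(ℂ, ℂ)) (z + a) := rfl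

/-- The set `HC({T_n})` of hypercyclic vectors of a sequence of continuous linear operators: the
vectors `x` whose orbit `{T_n x : n}` is dense. -/
def hypercyclicVectors {X : Type*} [AddCommMonoid X] [Module ℂ X] [TopologicalSpace X]
    (T : ℕ → X →L[ℂ] X) : Set X :=
  {x | Dense (Set.range fun n => T n x)}

/-- Condition `(Σ)`: for every `M > 0` there is a subsequence `μ_n = l (φ n)` of `l` with
`|μ_{n+1}| - |μ_n| > M` for all `n` and `∑ 1 / |μ_n| = +∞`. -/
def ConditionSigma (l : ℕ → ℂ) : Prop :=
  ∀ M : ℝ, 0 < M → ∃ φ : ℕ → ℕ, StrictMono φ ∧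
    (∀ n, M < ‖l (φ (n + 1))‖ - ‖l (φ n)‖) ∧
    Tendsto (fun N => ∑ n ∈ Finset.range N, 1 / ‖l (φ n)‖) atTop atTop

/-- The closed sector `{r e^{2πit} : r ∈ [r₀, R₀], t ∈ [θ₀, θT]}`. -/
def sector (r₀ R₀ θ₀ θT : ℝ) : Set ℂ :=
  {a | ∃ r ∈ Set.Icc r₀ R₀, ∃ t ∈ Set.Icc θ₀ θT,
    a = (r : ℂ) * Complex.exp (2 * Real.pi * Complex.I * t)}

/-! The set is Gδ, and by Baire's theorem it is dense as soon as, for a compact set `S` that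
avoids the origin and nonempty open sets `V` and `U`, some `F ∈ V` has the property that every
`a ∈ S` admits an `n` with `T_{l n * a} F ∈ U`.

Since `U` is open, if `F` looks on a large disc around `l n * b` like a suitable fixed function,
then `n` works for all `a` with `|l n| |a - b| ≤ δ`. So `S` has to be covered by finitely many
discs of radius `δ / |l n|` around points `b` in such a way that the products `l n * b` lie far
apart from each other and from the origin; Runge's theorem then yields one entire function `F`
with all the required behaviour, including `F ∈ V`.

To obtain the covering, choose a subsequence `μ` of `l` with large gaps and divergent
`∑ 1 / |μ n|`, and cut it into blocks of `q` consecutive terms. The `k`-th block serves the points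
`b` of a single circle, dealt out cyclically among its `q` multipliers: points with the same
multiplier may be a distance of order `1 / |μ|` apart, so together they are `q` times denser,
which for large `q` makes the discs of radius `δ / |μ|` cover a ring of thickness about `δ / |μ|`.
Points with different multipliers are separated by the gaps of `|μ|`. As the sum diverges,
finitely many rings cover `S`. Blocks over which `|μ|` more than doubles are skipped; those left
still have divergent sum. -/

section Topology

theorem isPreconnected_left_of_union_of_inter {X : Type*} [TopologicalSpace X] {V W : Set X}
    (hV : IsOpen V) (hW : IsOpen W) (hunion : IsPreconnected (V ∪ W))
    (hinter : IsPreconnected (V ∩ W)) : IsPreconnected V := by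
  have of_inter_subset : ∀ u v : Set X, IsOpen u → IsOpen v → V ⊆ u ∪ v → V ∩ (u ∩ v) = ∅ →
      V ∩ W ⊆ u → V ⊆ u ∨ V ⊆ v := by
    intro u v hu hv hcov hdisj hsub
    have hcov' : V ∪ W ⊆ (V ∩ u ∪ W) ∪ (V ∩ v) := by grind
    have hdisj' : (V ∪ W) ∩ ((V ∩ u ∪ W) ∩ (V ∩ v)) = ∅ := by grind
    have := isPreconnected_iff_subset_of_disjoint.1 hunion _ _ ((hV.inter hu).union hW)
      (hV.inter hv) hcov' hdisj'
    refine this.imp (fun h x hx => ?_) fun h x hx => (h (Or.inl hx)).2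
    exact (h (Or.inl hx)).elim And.right fun hxW => hsub ⟨hx, hxW⟩
  refine isPreconnected_iff_subset_of_disjoint.2 fun u v hu hv hcov hdisj => ?_
  rcases isPreconnected_iff_subset_of_disjoint.1 hinter u v hu hv
    (Set.inter_subset_left.trans hcov)
    (Set.subset_eq_empty (Set.inter_subset_inter_left _ Set.inter_subset_left) hdisj)
    with hsub | hsub
  · exact of_inter_subset u v hu hv hcov hdisj hsub
  · rw [Set.union_comm] at hcov
    rw [Set.inter_comm u] at hdisj
    exact (of_inter_subset v u hv hu hcov hdisj hsub).symm

variable {E : Type*} [NormedAddCommGroup E] [NormedSpace ℝ E]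

theorem isPreconnected_ball_diff_closedBall (h : 1 < Module.rank ℝ E) (x : E) (r r' : ℝ) :
    IsPreconnected (Metric.ball x r' \ Metric.closedBall x r) := by
  have : Nontrivial E := rank_pos_iff_nontrivial.1 (zero_lt_one.trans h)
  have himage : Metric.ball x r' \ Metric.closedBall x r =
      (fun p : ℝ × E => x + p.1 • p.2) '' ((Set.Ici 0 ∩ Set.Ioo r r') ×ˢ Metric.sphere 0 1) := by
    ext z
    simp only [Set.mem_sdiff, mem_ball_iff_norm, mem_closedBall_iff_norm, not_le, Set.mem_image,
      Set.mem_prod, Set.mem_inter_iff, Set.mem_Ici, Set.mem_Ioo, mem_sphere_zero_iff_norm,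
      Prod.exists]
    constructor
    · rintro ⟨hlt, hgt⟩
      obtain ⟨u, hu, hz⟩ : ∃ u : E, ‖u‖ = 1 ∧ ‖z - x‖ • u = z - x := by
        rcases eq_or_ne (z - x) 0 with h0 | h0
        · obtain ⟨u, hu⟩ := exists_norm_eq E zero_le_one
          exact ⟨u, hu, by simp [h0]⟩
        · exact ⟨‖z - x‖⁻¹ • (z - x), norm_smul_inv_norm h0,
            smul_inv_smul₀ (norm_ne_zero_iff.2 h0) _⟩
      exact ⟨‖z - x‖, u, ⟨⟨norm_nonneg _, hgt, hlt⟩, hu⟩, by rw [hz, add_sub_cancel]⟩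
    · rintro ⟨t, u, ⟨⟨ht, hgt, hlt⟩, hu⟩, rfl⟩
      simpa [norm_smul, hu, abs_of_nonneg ht] using ⟨hlt, hgt⟩
  rw [himage]
  exact (((Set.ordConnected_Ici.inter Set.ordConnected_Ioo).isPreconnected).prod
    (isPreconnected_sphere h 0 1)).image _ (by fun_prop)

theorem exists_ball_disjoint_biUnion_closedBall {α ι : Type*} [PseudoMetricSpace α]
    {s : Finset ι} {c : ι → α} {ρ : ι → ℝ} {x : α} {r : ℝ}
    (h : ∀ i ∈ s, r + ρ i < dist x (c i)) :
    ∃ r' > r, Disjoint (Metric.ball x r') (⋃ i ∈ s, Metric.closedBall (c i) (ρ i)) := by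
  have hev : ∀ᶠ r' in 𝓝[>] r, ∀ i ∈ s, r' + ρ i < dist x (c i) :=
    nhdsWithin_le_nhds <| (Finset.eventually_all s).2 fun i hi =>
      (continuous_id.add_const (ρ i)).continuousAt.eventually_lt_const (h i hi)
  obtain ⟨r', hr', hlt⟩ := (hev.and self_mem_nhdsWithin).exists
  exact ⟨r', hlt, Set.disjoint_iUnion₂_right.2 fun i hi =>
    Metric.ball_disjoint_closedBall (hr' i hi).le⟩

theorem isPreconnected_compl_biUnion_closedBall (h : 1 < Module.rank ℝ E) {ι : Type*}
    {s : Finset ι} {c : ι → E} {ρ : ι → ℝ}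
    (hs : (s : Set ι).Pairwise fun i j => ρ i + ρ j < dist (c i) (c j)) :
    IsPreconnected (⋃ i ∈ s, Metric.closedBall (c i) (ρ i))ᶜ := by
  classical
  induction s using Finset.induction_on with
  | empty => simpa using isPreconnected_univ
  | insert i s hi ih =>
    have hsep : ∀ j ∈ s, ρ i + ρ j < dist (c i) (c j) := fun j hj =>
      hs (by simp) (by simp [hj]) (by rintro rfl; exact hi hj)
    obtain ⟨r', hr', hdisj⟩ := exists_ball_disjoint_biUnion_closedBall hsep
    have ih' := ih (hs.mono (by simp))
    have hclosed : IsClosed (⋃ j ∈ s, Metric.closedBall (c j) (ρ j)) :=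
      s.finite_toSet.isClosed_biUnion fun _ _ => Metric.isClosed_closedBall
    have hball := Metric.closedBall_subset_ball (x := c i) hr'
    rw [Finset.set_biUnion_insert]
    refine isPreconnected_left_of_union_of_inter
      (Metric.isClosed_closedBall.union hclosed).isOpen_compl
      (Metric.isOpen_ball (x := c i) (ε := r')) ?_ ?_
    · convert ih' using 1
      grind
    · convert isPreconnected_ball_diff_closedBall h (c i) (ρ i) r' using 1
      grind

end Topology

section Runge

/-- The uniform closure in `C(K, ℂ)` of the restrictions to `K` of the entire functions. -/
noncomputable def entireClosure (K : Set ℂ) [CompactSpace K] : Subalgebra ℂ C(K, ℂ) :=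
  ((entireFunctions.toSubalgebra (differentiable_const 1) fun _ _ => Differentiable.mul).map
    (ContinuousMap.compRightAlgHom ℂ ℂ ⟨Subtype.val, continuous_subtype_val⟩)).topologicalClosure

section Closure

variable {K : Set ℂ} [CompactSpace K]

theorem isClosed_entireClosure : IsClosed (entireClosure K : Set C(K, ℂ)) :=
  Subalgebra.isClosed_topologicalClosure _

theorem restrict_mem_entireClosure {f : C(ℂ, ℂ)} (hf : f ∈ entireFunctions) :
    f.restrict K ∈ entireClosure K :=
  Subalgebra.le_topologicalClosure _ ⟨f, hf, rfl⟩

theorem exists_entireFunctions_near_of_mem_entireClosure {g : C(K, ℂ)}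
    (hg : g ∈ entireClosure K) {ε : ℝ} (hε : 0 < ε) :
    ∃ f : entireFunctions, ∀ z : K, ‖(f : C(ℂ, ℂ)) z - g z‖ < ε := by
  obtain ⟨_, ⟨f, hf, rfl⟩, hfg⟩ := Metric.mem_closure_iff.1 hg ε hε
  refine ⟨⟨f, hf⟩, fun z => ?_⟩
  rw [← dist_eq_norm, dist_comm]
  exact (ContinuousMap.dist_lt_iff hε).1 hfg z

-- The complement of `K` is connected, so passing to the subalgebra does not enlarge the spectrum
-- of the coordinate function, which is `K`.
theorem exists_mem_entireClosure_eq_inv_eval (hconn : IsPreconnected Kᶜ) {q : Polynomial ℂ}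
    (hq : ∀ z ∈ K, q.eval z ≠ 0) : ∃ y ∈ entireClosure K, ∀ z : K, y z = (q.eval (z : ℂ))⁻¹ := by
  rcases K.eq_empty_or_nonempty with rfl | hK
  · exact ⟨0, zero_mem _, fun z => z.2.elim⟩
  have : IsClosed (entireClosure K : Set C(K, ℂ)) := isClosed_entireClosure
  let x : entireClosure K :=
    ⟨_, restrict_mem_entireClosure (f := ContinuousMap.id ℂ) differentiable_id⟩
  have hcoe : spectrum ℂ (x : C(K, ℂ)) = K := by
    rw [ContinuousMap.spectrum_eq_range]
    exact Subtype.range_coe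
  have hx : spectrum ℂ x = K := by
    rw [Subalgebra.spectrum_eq_of_isPreconnected_compl (entireClosure K) x (by rwa [hcoe]), hcoe]
  have hunit : IsUnit (Polynomial.aeval x q) := by
    rw [← spectrum.zero_notMem_iff ℂ,
      spectrum.map_polynomial_aeval_of_nonempty x q (by rwa [hx]), hx]
    rintro ⟨z, hz, h0⟩
    exact hq z hz h0
  obtain ⟨y, hy⟩ := hunit.exists_right_inv
  refine ⟨y, y.2, fun z => eq_inv_of_mul_eq_one_right ?_⟩
  simpa [x] using DFunLike.congr_fun (congrArg Subtype.val hy) z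

end Closure

section InvOneSub

variable {𝕜 : Type*} [NormedDivisionRing 𝕜] {w : 𝕜} {t : ℝ}

theorem norm_inv_one_sub_sub_one_le (ht : t < 1) (hw : ‖w‖ ≤ t) :
    ‖(1 - w)⁻¹ - 1‖ ≤ t / (1 - t) := by
  have hle : 1 - t ≤ ‖1 - w‖ := by linarith [norm_sub_norm_le 1 w, norm_one (α := 𝕜)]
  have hne : 1 - w ≠ 0 := norm_pos_iff.1 (by linarith)
  calc ‖(1 - w)⁻¹ - 1‖ = ‖(1 - w)⁻¹ * w‖ := by
        congr 1
        rw [eq_inv_mul_iff_mul_eq₀ hne, mul_sub, mul_inv_cancel₀ hne, mul_one, sub_sub_cancel]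
    _ = ‖w‖ / ‖1 - w‖ := by rw [norm_mul, norm_inv, inv_mul_eq_div]
    _ ≤ t / (1 - t) := div_le_div₀ ((norm_nonneg w).trans hw) hw (by linarith) hle

theorem norm_inv_one_sub_le (ht₀ : 0 < t) (ht : t < 1) (hw : t⁻¹ ≤ ‖w‖) :
    ‖(1 - w)⁻¹‖ ≤ t / (1 - t) := by
  have hle : (1 - t) / t ≤ ‖1 - w‖ := by
    rw [sub_div, div_self ht₀.ne', one_div, norm_sub_rev]
    linarith [norm_sub_norm_le w 1, norm_one (α := 𝕜)]
  rw [norm_inv, ← inv_div]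
  gcongr

end InvOneSub

section Indicator

variable {K : Set ℂ} [CompactSpace K]

theorem exists_mem_entireClosure_norm_sub_indicator_le (hconn : IsPreconnected Kᶜ)
    {q : Polynomial ℂ} {t : ℝ} (ht₀ : 0 < t) (ht : t < 1)
    (hq : ∀ z ∈ K, ‖q.eval z‖ ≤ t ∨ t⁻¹ ≤ ‖q.eval z‖) :
    ∃ y ∈ entireClosure K,
      ∀ z : K, ‖y z - {z | ‖q.eval z‖ < 1}.indicator 1 (z : ℂ)‖ ≤ t / (1 - t) := by
  have ht₁ : 1 < t⁻¹ := (one_lt_inv₀ ht₀).2 ht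
  have hne : ∀ z ∈ K, (1 - q).eval z ≠ 0 := fun z hz h0 => by
    have h1 : ‖q.eval z‖ = 1 := by
      rw [← sub_eq_zero.1 (by simpa using h0 : 1 - q.eval z = 0), norm_one]
    rcases hq z hz with h | h <;> linarith
  obtain ⟨y, hy_mem, hy⟩ := exists_mem_entireClosure_eq_inv_eval hconn hne
  refine ⟨y, hy_mem, fun z => ?_⟩
  rw [hy z, Polynomial.eval_sub, Polynomial.eval_one]
  rcases hq z z.2 with h | h
  · have hmem : (z : ℂ) ∈ {z | ‖q.eval z‖ < 1} := h.trans_lt ht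
    rw [Set.indicator_of_mem hmem, Pi.one_apply]
    exact norm_inv_one_sub_sub_one_le ht h
  · have hnot : (z : ℂ) ∉ {z | ‖q.eval z‖ < 1} := (ht₁.trans_le h).not_gt
    rw [Set.indicator_of_notMem hnot, sub_zero]
    exact norm_inv_one_sub_le ht₀ ht h

-- The indicator is the uniform limit on `K` of `1 / (1 - q ^ N)`.
theorem exists_mem_entireClosure_eq_indicator (hconn : IsPreconnected Kᶜ) {q : Polynomial ℂ}
    {t : ℝ} (ht₀ : 0 < t) (ht : t < 1) (hq : ∀ z ∈ K, ‖q.eval z‖ ≤ t ∨ t⁻¹ ≤ ‖q.eval z‖) :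
    ∃ χ ∈ entireClosure K, ∀ z : K, χ z = {z | ‖q.eval z‖ < 1}.indicator 1 (z : ℂ) := by
  have hclopen : IsClopen {z : K | ‖q.eval (z : ℂ)‖ < 1} := by
    refine ⟨?_, isOpen_lt (by fun_prop) continuous_const⟩
    have : {z : K | ‖q.eval (z : ℂ)‖ < 1} = {z : K | ‖q.eval (z : ℂ)‖ ≤ t} := by
      ext z
      refine ⟨fun h => (hq z z.2).resolve_right fun h' => ?_, fun h => lt_of_le_of_lt h ht⟩
      exact ((one_lt_inv₀ ht₀).2 ht).not_ge (h'.trans (Set.mem_ofPred.1 h).le)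
    rw [this]
    exact isClosed_le (by fun_prop) continuous_const
  let χ : C(K, ℂ) := (LocallyConstant.charFn ℂ hclopen : C(K, ℂ))
  have hχ : ∀ z : K, χ z = {z | ‖q.eval z‖ < 1}.indicator 1 (z : ℂ) := fun z =>
    congrFun (LocallyConstant.coe_charFn ℂ hclopen) z
  refine ⟨χ, isClosed_entireClosure.closure_subset (Metric.mem_closure_iff.2 fun ε hε => ?_), hχ⟩
  have hlim : Tendsto (fun N : ℕ => t ^ N / (1 - t ^ N)) atTop (𝓝 0) := by
    have := tendsto_pow_atTop_nhds_zero_of_lt_one ht₀.le ht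
    simpa [Pi.div_def] using this.div (this.const_sub 1) (by simp)
  obtain ⟨N, hN, hN₀⟩ := ((hlim.eventually_lt_const hε).and (eventually_ne_atTop 0)).exists
  have hset : {z | ‖(q ^ N).eval z‖ < 1} = {z | ‖q.eval z‖ < 1} := by
    ext z
    simp [pow_lt_one_iff_of_nonneg (norm_nonneg _) hN₀]
  obtain ⟨y, hy_mem, hy⟩ := exists_mem_entireClosure_norm_sub_indicator_le hconn (q := q ^ N)
    (pow_pos ht₀ N) (pow_lt_one₀ ht₀.le ht hN₀) fun z hz => by
      rw [Polynomial.eval_pow, norm_pow, ← inv_pow]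
      exact (hq z hz).imp (fun h => by gcongr) fun h => by gcongr
  rw [hset] at hy
  refine ⟨y, hy_mem, (ContinuousMap.dist_lt_iff hε).2 fun z => ?_⟩
  rw [dist_comm, dist_eq_norm, hχ]
  exact (hy z).trans_lt hN

theorem exists_mem_entireClosure_eq_indicator_closedBall (hconn : IsPreconnected Kᶜ) {c : ℂ}
    {ρ ρ' : ℝ} (hρ : 0 ≤ ρ) (hlt : ρ < ρ')
    (hK : K ⊆ Metric.closedBall c ρ ∪ (Metric.ball c ρ')ᶜ) :
    ∃ χ ∈ entireClosure K, ∀ z : K, χ z = (Metric.closedBall c ρ).indicator 1 (z : ℂ) := by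
  obtain ⟨s, hρs, hsρ'⟩ := exists_between hlt
  have hs : 0 < s := hρ.trans_lt hρs
  have hq : ∀ z, ‖(Polynomial.C (s : ℂ)⁻¹ * (Polynomial.X - Polynomial.C c)).eval z‖ =
      dist z c / s := fun z => by simp [dist_eq_norm, abs_of_pos hs, inv_mul_eq_div]
  obtain ⟨χ, hχ_mem, hχ⟩ := exists_mem_entireClosure_eq_indicator hconn
    (q := Polynomial.C (s : ℂ)⁻¹ * (Polynomial.X - Polynomial.C c)) (t := max (ρ / s) (s / ρ'))
    (lt_max_of_lt_right (div_pos hs (hs.trans hsρ')))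
    (max_lt ((div_lt_one hs).2 hρs) ((div_lt_one (hs.trans hsρ')).2 hsρ')) fun z hz => by
      rw [hq]
      refine (hK hz).imp (fun h => le_max_of_le_left ?_) fun h =>
        (inv_anti₀ (div_pos hs (hs.trans hsρ')) (le_max_right _ _)).trans ?_
      · exact div_le_div_of_nonneg_right h hs.le
      · rw [inv_div]
        exact div_le_div_of_nonneg_right (not_lt.1 h) hs.le
  refine ⟨χ, hχ_mem, fun z => (hχ z).trans ?_⟩
  simp only [hq, div_lt_one hs]
  rcases hK z.2 with h | h
  · have hmem : (z : ℂ) ∈ {z | dist z c < s} := (Metric.mem_closedBall.1 h).trans_lt hρs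
    rw [Set.indicator_of_mem h, Set.indicator_of_mem hmem]
  · have hle : ρ' ≤ dist (z : ℂ) c := not_lt.1 h
    rw [Set.indicator_of_notMem, Set.indicator_of_notMem]
    · exact (hlt.trans_le hle).not_ge
    · exact (hsρ'.trans_le hle).not_gt

end Indicator

theorem exists_entireFunctions_near_on_closedBalls {ι : Type*} {s : Finset ι} {c : ι → ℂ}
    {ρ : ι → ℝ} (hρ : ∀ i ∈ s, 0 ≤ ρ i)
    (hs : (s : Set ι).Pairwise fun i j => ρ i + ρ j < dist (c i) (c j)) (f : ι → entireFunctions)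
    {ε : ℝ} (hε : 0 < ε) :
    ∃ F : entireFunctions, ∀ i ∈ s, ∀ z ∈ Metric.closedBall (c i) (ρ i),
      ‖(F : C(ℂ, ℂ)) z - (f i : C(ℂ, ℂ)) z‖ < ε := by
  classical
  set K : Set ℂ := ⋃ i ∈ s, Metric.closedBall (c i) (ρ i)
  have : CompactSpace K := isCompact_iff_compactSpace.1 <|
    s.isCompact_biUnion fun i _ => isCompact_closedBall (c i) (ρ i)
  have hconn : IsPreconnected Kᶜ :=
    isPreconnected_compl_biUnion_closedBall (by simp [Complex.rank_real_complex]) hs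
  have hχ : ∀ i ∈ s, ∃ χ ∈ entireClosure K, ∀ z : K,
      χ z = (Metric.closedBall (c i) (ρ i)).indicator 1 (z : ℂ) := fun i hi => by
    obtain ⟨r, hr, hdisj⟩ := exists_ball_disjoint_biUnion_closedBall (s := s.erase i)
      fun j hj => hs hi (Finset.mem_of_mem_erase hj) (Finset.ne_of_mem_erase hj).symm
    refine exists_mem_entireClosure_eq_indicator_closedBall hconn (hρ i hi) hr ?_
    rw [← Set.subset_compl_iff_disjoint_left] at hdisj
    refine Set.iUnion₂_subset fun j hj => ?_
    rcases eq_or_ne j i with rfl | hji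
    · exact Set.subset_union_left
    · exact ((Set.subset_biUnion_of_mem (Finset.mem_erase.2 ⟨hji, hj⟩)).trans hdisj).trans
        Set.subset_union_right
  choose! χ hχ_mem hχ_apply using hχ
  obtain ⟨F, hF⟩ := exists_entireFunctions_near_of_mem_entireClosure
    (g := ∑ i ∈ s, (f i : C(ℂ, ℂ)).restrict K * χ i)
    (sum_mem fun i hi => mul_mem (restrict_mem_entireClosure (f i).2) (hχ_mem i hi)) hε
  refine ⟨F, fun i hi z hz => ?_⟩
  have hzK : z ∈ K := Set.mem_biUnion hi hz
  convert hF ⟨z, hzK⟩ using 3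
  have hzero : ∀ j ∈ s, j ≠ i → χ j ⟨z, hzK⟩ = 0 := fun j hj hji => by
    rw [hχ_apply j hj, Set.indicator_of_notMem]
    exact Set.disjoint_right.1 (Metric.closedBall_disjoint_closedBall (hs hj hi hji)) hz
  simp only [ContinuousMap.sum_apply, ContinuousMap.mul_apply]
  rw [Finset.sum_eq_single_of_mem i hi fun j hj hji => by rw [hzero j hj hji, mul_zero],
    hχ_apply i hi, Set.indicator_of_mem hz, Pi.one_apply, mul_one]
  rfl

end Runge

section FourierChar

open Real
open scoped FourierTransform

theorem norm_fourierChar_sub_fourierChar (s t : ℝ) :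
    ‖(𝐞 s - 𝐞 t : ℂ)‖ = 2 * |Real.sin (π * (s - t))| := by
  have hfactor : (𝐞 s - 𝐞 t : ℂ) = 𝐞 t * (Complex.exp (Complex.I * (2 * π * (s - t) : ℝ)) - 1) := by
    rw [Real.fourierChar_apply, Real.fourierChar_apply, mul_sub, ← Complex.exp_add]
    push_cast
    ring_nf
  rw [hfactor, norm_mul, Circle.norm_coe, one_mul, Complex.norm_exp_I_mul_ofReal_sub_one]
  simp [mul_assoc]

theorem norm_fourierChar_sub_fourierChar_le (s t : ℝ) : ‖(𝐞 s - 𝐞 t : ℂ)‖ ≤ 2 * π * |s - t| := by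
  calc ‖(𝐞 s - 𝐞 t : ℂ)‖ = 2 * |Real.sin (π * (s - t))| := norm_fourierChar_sub_fourierChar s t
    _ ≤ 2 * |π * (s - t)| := by gcongr ?_ * ?_; exact Real.abs_sin_le_abs
    _ = 2 * π * |s - t| := by rw [abs_mul, abs_of_pos Real.pi_pos, mul_assoc]

theorem le_norm_fourierChar_sub_fourierChar {s t x : ℝ} (hx : x ≤ |s - t|)
    (hx' : |s - t| ≤ 1 - x) : 4 * x ≤ ‖(𝐞 s - 𝐞 t : ℂ)‖ := by
  rcases lt_or_ge x 0 with hx₀ | hx₀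
  · exact (by linarith : 4 * x ≤ 0).trans (norm_nonneg _)
  have hpi := Real.pi_pos
  have hsin : 2 * x ≤ Real.sin (π * |s - t|) := by
    rcases le_total |s - t| (1 / 2) with h | h
    · calc 2 * x ≤ 2 * |s - t| := by gcongr
        _ = 2 / π * (π * |s - t|) := by field_simp
        _ ≤ _ := Real.mul_le_sin (by positivity) (by nlinarith)
    · calc 2 * x ≤ 2 * (1 - |s - t|) := by linarith
        _ = 2 / π * (π - π * |s - t|) := by field_simp
        _ ≤ Real.sin (π - π * |s - t|) := Real.mul_le_sin (by nlinarith) (by nlinarith)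
        _ = _ := Real.sin_pi_sub _
  have habs : |Real.sin (π * (s - t))| = |Real.sin (π * |s - t|)| := by
    rcases abs_choice (s - t) with h | h <;> simp only [h, mul_neg, Real.sin_neg, abs_neg]
  rw [norm_fourierChar_sub_fourierChar, habs]
  linarith [le_abs_self (Real.sin (π * |s - t|))]

theorem exists_norm_mul_fourierChar_eq (a : ℂ) : ∃ t ∈ Set.Ico (0 : ℝ) 1, (‖a‖ * 𝐞 t : ℂ) = a := by
  refine ⟨Int.fract (a.arg / (2 * π)), ⟨Int.fract_nonneg _, Int.fract_lt_one _⟩, ?_⟩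
  conv_rhs => rw [← Complex.norm_mul_exp_arg_mul_I a]
  rw [Real.fourierChar_apply, Int.fract,
    ← Complex.exp_periodic.sub_int_mul_eq (x := a.arg * Complex.I) ⌊a.arg / (2 * π)⌋]
  congr 2
  push_cast
  field_simp

theorem exists_norm_sub_norm_mul_fourierChar_le (a : ℂ) {N : ℕ} (hN : 0 < N) :
    ∃ m < N, ‖a - ‖a‖ * 𝐞 (m / N)‖ ≤ 2 * π * ‖a‖ / N := by
  obtain ⟨t, ⟨ht₀, ht₁⟩, ht⟩ := exists_norm_mul_fourierChar_eq a
  have hN' : (0 : ℝ) < N := Nat.cast_pos.2 hN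
  have htN : 0 ≤ N * t := by positivity
  refine ⟨⌊N * t⌋₊, (Nat.floor_lt htN).2 (mul_lt_of_lt_one_right hN' ht₁), ?_⟩
  have hdist : |t - ⌊N * t⌋₊ / N| ≤ 1 / N := by
    have hfloor : |N * t - ⌊N * t⌋₊| ≤ 1 := by
      rw [abs_of_nonneg (sub_nonneg.2 (Nat.floor_le htN))]
      linarith [Nat.lt_floor_add_one (N * t)]
    calc |t - ⌊N * t⌋₊ / N| = |N * t - ⌊N * t⌋₊| / N := by
          rw [← abs_of_pos hN', ← abs_div, abs_of_pos hN', sub_div, mul_div_cancel_left₀ _ hN'.ne']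
      _ ≤ 1 / N := by gcongr
  calc ‖a - ‖a‖ * 𝐞 (⌊N * t⌋₊ / N)‖ = ‖a‖ * ‖(𝐞 t - 𝐞 (⌊N * t⌋₊ / N) : ℂ)‖ := by
        nth_rw 1 [← ht]
        rw [← mul_sub, norm_mul, Complex.norm_real, norm_norm]
    _ ≤ ‖a‖ * (2 * π * (1 / N)) := by
        gcongr
        exact (norm_fourierChar_sub_fourierChar_le _ _).trans (by gcongr)
    _ = 2 * π * ‖a‖ / N := by ring

end FourierChar

section Radii

theorem not_summable_comp_mul_right_of_antitone {f : ℕ → ℝ} (hf : Antitone f) (hf₀ : ∀ n, 0 ≤ f n)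
    (h : ¬Summable f) {q : ℕ} (hq : 0 < q) : ¬Summable fun k => f (k * q) := by
  have hblock : SuccDiffBounded 1 fun k => (k + 1) * q := fun k =>
    (by simp [Nat.succ_mul] : (k + 1 + 1 + 1) * q - (k + 1 + 1) * q ≤
      1 • ((k + 1 + 1) * q - (k + 1) * q))
  have hiff := summable_schlomilch_iff_of_nonneg hf₀ (fun m n _ hmn => hf hmn)
    (fun k => Nat.mul_pos k.succ_pos hq)
    (fun m n hmn => Nat.mul_lt_mul_of_pos_right (Nat.succ_lt_succ hmn) hq) one_ne_zero hblock
  have hdiff : ∀ k : ℕ, (((k + 1 + 1) * q : ℕ) - ((k + 1) * q : ℕ) : ℝ) = q := fun k => by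
    push_cast
    ring
  simp only [hdiff] at hiff
  rwa [← hiff, summable_mul_left_iff (Nat.cast_ne_zero.2 hq.ne'),
    summable_nat_add_iff (f := fun k => f (k * q)) 1] at h

theorem not_summable_max_zero_two_mul_sub {u : ℕ → ℝ} (hu₀ : ∀ n, 0 ≤ u n) (h : ¬Summable u) :
    ¬Summable fun k => max 0 (2 * u (k + 1) - u k) := by
  intro hd
  refine h (summable_of_sum_range_le (c := 2 * u 0 + ∑' k, max 0 (2 * u (k + 1) - u k)) hu₀
    fun n => ?_)
  have htelescope : ∑ k ∈ Finset.range n, (u (k + 1) - u k) = u n - u 0 :=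
    Finset.sum_range_sub u n
  calc ∑ k ∈ Finset.range n, u k
      = ∑ k ∈ Finset.range n, (2 * u (k + 1) - u k) - 2 * (u n - u 0) := by
        rw [← htelescope, Finset.mul_sum, ← Finset.sum_sub_distrib]
        exact Finset.sum_congr rfl fun k _ => by ring
    _ ≤ ∑ k ∈ Finset.range n, max 0 (2 * u (k + 1) - u k) + 2 * u 0 := by
        have := Finset.sum_le_sum fun k (_ : k ∈ Finset.range n) =>
          le_max_right 0 (2 * u (k + 1) - u k)
        linarith [hu₀ n]
    _ ≤ 2 * u 0 + ∑' k, max 0 (2 * u (k + 1) - u k) := by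
        rw [add_comm]
        gcongr
        exact hd.sum_le_tsum _ fun k _ => le_max_left _ _

-- The increments `c * max 0 (2 * u (k + 1) - u k)` vanish wherever `u` drops by half or more, and
-- still have infinite sum.
theorem exists_radii {u : ℕ → ℝ} (hu₀ : ∀ k, 0 ≤ u k) (hu : Antitone u) (h : ¬Summable u) {c : ℝ}
    (hc : 0 < c) (r : ℝ) :
    ∃ ρ : ℕ → ℝ, ρ 0 = r ∧ Monotone ρ ∧ Tendsto ρ atTop atTop ∧
      ∀ k, ρ k < ρ (k + 1) → u k < 2 * u (k + 1) ∧ ρ (k + 1) - ρ k ≤ c * u (k + 1) := by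
  set d : ℕ → ℝ := fun k => max 0 (2 * u (k + 1) - u k)
  have hd₀ : ∀ k, 0 ≤ d k := fun k => le_max_left _ _
  have hd_lim : Tendsto (fun k => ∑ i ∈ Finset.range k, d i) atTop atTop :=
    (not_summable_iff_tendsto_nat_atTop_of_nonneg hd₀).1 (not_summable_max_zero_two_mul_sub hu₀ h)
  have hstep : ∀ k, r + c * ∑ i ∈ Finset.range (k + 1), d i -
      (r + c * ∑ i ∈ Finset.range k, d i) = c * d k := fun k => by
    rw [Finset.sum_range_succ]
    ring
  refine ⟨fun k => r + c * ∑ i ∈ Finset.range k, d i, by simp,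
    monotone_nat_of_le_succ fun k => sub_nonneg.1 ?_,
    tendsto_atTop_add_const_left _ _ (hd_lim.const_mul_atTop hc), fun k hk => ?_⟩
  · rw [hstep]
    exact mul_nonneg hc.le (hd₀ k)
  · have hdk : 0 < d k := by
      rw [← sub_pos, hstep] at hk
      exact pos_of_mul_pos_right hk hc.le
    have hlt : u k < 2 * u (k + 1) := by simpa [d] using hdk
    refine ⟨hlt, ?_⟩
    rw [hstep]
    gcongr
    exact max_le (hu₀ _) (by linarith [hu k.le_succ])

theorem exists_radii_of_not_summable_one_div {ν : ℕ → ℝ} (hpos : ∀ n, 0 < ν n) (hmono : Monotone ν)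
    (h : ¬Summable fun n => 1 / ν n) {q : ℕ} (hq : 0 < q) {c : ℝ} (hc : 0 < c) (r : ℝ) :
    ∃ ρ : ℕ → ℝ, ρ 0 = r ∧ Monotone ρ ∧ Tendsto ρ atTop atTop ∧
      ∀ k, ρ k < ρ (k + 1) → ν ((k + 1) * q) ≤ 2 * ν (k * q) ∧
        ν ((k + 1) * q) * (ρ (k + 1) - ρ k) ≤ c := by
  have hnonneg : ∀ n, 0 ≤ 1 / ν n := fun n => (one_div_pos.2 (hpos n)).le
  have hanti : Antitone fun n => 1 / ν n := fun m n hmn =>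
    one_div_le_one_div_of_le (hpos m) (hmono hmn)
  obtain ⟨ρ, hρ₀, hρ_mono, hρ_lim, hρ_step⟩ := exists_radii (fun k => hnonneg (k * q))
    (fun j k hjk => hanti (Nat.mul_le_mul_right q hjk))
    (not_summable_comp_mul_right_of_antitone hanti hnonneg h hq) hc r
  refine ⟨ρ, hρ₀, hρ_mono, hρ_lim, fun k hk => ?_⟩
  obtain ⟨hdouble, hstep⟩ := hρ_step k hk
  rw [mul_one_div, div_lt_div_iff₀ (hpos _) (hpos _)] at hdouble
  rw [mul_one_div, le_div_iff₀' (hpos _)] at hstep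
  exact ⟨by linarith, hstep⟩

end Radii

theorem ConditionSigma.exists_subsequence {l : ℕ → ℂ} (hl : ConditionSigma l) {M : ℝ}
    (hM : 0 < M) :
    ∃ φ : ℕ → ℕ, (∀ n, M ≤ ‖l (φ n)‖) ∧ (∀ m n, m < n → ‖l (φ m)‖ + M ≤ ‖l (φ n)‖) ∧
      ¬Summable fun n => 1 / ‖l (φ n)‖ := by
  obtain ⟨φ, -, hgap, hdiv⟩ := hl M hM
  have hmono : Monotone fun n => ‖l (φ n)‖ := monotone_nat_of_le_succ fun n => by
    linarith [hgap n]
  refine ⟨fun n => φ (n + 1), fun n => ?_, fun m n hmn => ?_, ?_⟩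
  · linarith [hgap n, norm_nonneg (l (φ n))]
  · linarith [hgap (m + 1), hmono (Nat.succ_le_succ hmn)]
  · rw [summable_nat_add_iff (f := fun n => 1 / ‖l (φ n)‖) 1,
      not_summable_iff_tendsto_nat_atTop_of_nonneg fun n => by positivity]
    exact hdiv

section SeparatedNet

open Real
open scoped FourierTransform

/-- A finite family of multipliers `ν p` and points `b p` such that the products `ν p * b p` are
`L`-separated from each other and from the origin, while the discs of radius `δ / ‖ν p‖` around the
`b p` cover `S`. Translates by `ν p * b p` can then be prescribed independently of each other. -/
structure IsSeparatedNet {ι : Type*} (P : Finset ι) (ν b : ι → ℂ) (S : Set ℂ) (L δ : ℝ) :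
    Prop where
  le_norm : ∀ p ∈ P, L ≤ ‖ν p * b p‖
  pairwise_le_dist : (P : Set ι).Pairwise fun p p' => L ≤ dist (ν p * b p) (ν p' * b p')
  exists_norm_mul_sub_le : ∀ a ∈ S, ∃ p ∈ P, ‖ν p * (a - b p)‖ ≤ δ

theorem IsSeparatedNet.mono {ι : Type*} {P : Finset ι} {ν b : ι → ℂ} {S S' : Set ℂ} {L δ : ℝ}
    (h : IsSeparatedNet P ν b S' L δ) (hS : S ⊆ S') : IsSeparatedNet P ν b S L δ :=
  ⟨h.le_norm, h.pairwise_le_dist, fun a ha => h.exists_norm_mul_sub_le a (hS ha)⟩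

/-- The `i`-th point attached to the `n`-th multiplier. The circle of radius `ρ k` carries `q * N k`
equidistant points, dealt out cyclically to the `q` multipliers with indices in
`[k * q, (k + 1) * q)`; so the points that share a multiplier are `1 / N k` of a turn apart. -/
noncomputable def ringPoint (ρ : ℕ → ℝ) (N : ℕ → ℕ) (q n i : ℕ) : ℂ :=
  ρ (n / q) * 𝐞 ((n % q + q * i : ℕ) / (q * N (n / q) : ℕ))

variable {ρ : ℕ → ℝ} {N : ℕ → ℕ} {q : ℕ}

theorem norm_ringPoint {n i : ℕ} (hρ : 0 ≤ ρ (n / q)) : ‖ringPoint ρ N q n i‖ = ρ (n / q) := by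
  rw [ringPoint, norm_mul, Circle.norm_coe, mul_one, Complex.norm_of_nonneg hρ]

theorem le_dist_ringPoint {n i j : ℕ} (hq : 0 < q) (hρ : 0 ≤ ρ (n / q)) (hi : i < N (n / q))
    (hj : j < N (n / q)) (hij : i ≠ j) :
    4 * ρ (n / q) / N (n / q) ≤ dist (ringPoint ρ N q n i) (ringPoint ρ N q n j) := by
  have hN : (0 : ℝ) < N (n / q) := Nat.cast_pos.2 (i.zero_le.trans_lt hi)
  have hangle : |((n % q + q * i : ℕ) / (q * N (n / q) : ℕ) : ℝ) -
      (n % q + q * j : ℕ) / (q * N (n / q) : ℕ)| = |(i - j : ℝ)| / N (n / q) := by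
    rw [← abs_of_pos hN, ← abs_div]
    push_cast
    congr 1
    field_simp
    ring
  have hij_ge : (1 : ℝ) ≤ |(i - j : ℝ)| := by
    exact_mod_cast Int.one_le_abs (sub_ne_zero.2 (Nat.cast_injective.ne hij : (i : ℤ) ≠ j))
  have hij_le : |(i - j : ℝ)| ≤ N (n / q) - 1 := by
    have : (i : ℝ) + 1 ≤ N (n / q) := by exact_mod_cast hi
    have : (j : ℝ) + 1 ≤ N (n / q) := by exact_mod_cast hj
    rw [abs_le]
    constructor <;> linarith [i.cast_nonneg (α := ℝ), j.cast_nonneg (α := ℝ)]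
  calc 4 * ρ (n / q) / N (n / q) = ρ (n / q) * (4 * (1 / N (n / q))) := by ring
    _ ≤ ρ (n / q) * ‖(𝐞 ((n % q + q * i : ℕ) / (q * N (n / q) : ℕ)) -
          𝐞 ((n % q + q * j : ℕ) / (q * N (n / q) : ℕ)) : ℂ)‖ := by
        gcongr
        apply le_norm_fourierChar_sub_fourierChar <;> rw [hangle]
        · gcongr
        · rw [div_le_iff₀ hN, sub_mul, div_mul_cancel₀ _ hN.ne', one_mul]
          exact hij_le
    _ = dist (ringPoint ρ N q n i) (ringPoint ρ N q n j) := by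
        rw [dist_eq_norm, ringPoint, ringPoint, ← mul_sub, norm_mul, Complex.norm_of_nonneg hρ]

theorem exists_norm_sub_ringPoint_le {a : ℂ} {k : ℕ} (hq : 0 < q) (hN : 0 < N k)
    (ha : ρ k ≤ ‖a‖) :
    ∃ n i, n / q = k ∧ i < N k ∧
      ‖a - ringPoint ρ N q n i‖ ≤ ‖a‖ - ρ k + 2 * π * ‖a‖ / (q * N k) := by
  obtain ⟨m, hm, hma⟩ := exists_norm_sub_norm_mul_fourierChar_le a (Nat.mul_pos hq hN)
  have hdiv : (k * q + m % q) / q = k := by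
    rw [add_comm, Nat.add_mul_div_right _ _ hq, Nat.div_eq_of_lt (Nat.mod_lt _ hq), zero_add]
  refine ⟨k * q + m % q, m / q, hdiv, Nat.div_lt_of_lt_mul hm, ?_⟩
  have hpoint : ringPoint ρ N q (k * q + m % q) (m / q) = ρ k * 𝐞 (m / (q * N k : ℕ)) := by
    rw [ringPoint, hdiv, Nat.mul_add_mod_self_right, Nat.mod_mod, Nat.mod_add_div]
  have hsplit : a - ρ k * 𝐞 (m / (q * N k : ℕ)) =
      (a - ‖a‖ * 𝐞 (m / (q * N k : ℕ))) + ((‖a‖ - ρ k : ℝ) : ℂ) * 𝐞 (m / (q * N k : ℕ)) := by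
    push_cast
    ring
  rw [hpoint, hsplit]
  refine (norm_add_le _ _).trans ?_
  rw [norm_mul, Circle.norm_coe, mul_one, Complex.norm_of_nonneg (sub_nonneg.2 ha), add_comm]
  push_cast at hma ⊢
  gcongr

theorem mul_le_dist_mul_mul {𝕜 : Type*} [NormedDivisionRing 𝕜] {x x' y y' : 𝕜} {M r : ℝ}
    (hM : 0 ≤ M) (hx : ‖x‖ + M ≤ ‖x'‖) (hr : r ≤ ‖y‖) (hy : ‖y‖ ≤ ‖y'‖) :
    M * r ≤ dist (x * y) (x' * y') := by
  calc M * r ≤ M * ‖y‖ := by gcongr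
    _ ≤ (‖x'‖ - ‖x‖) * ‖y‖ := by gcongr; linarith
    _ = ‖x'‖ * ‖y‖ - ‖x‖ * ‖y‖ := sub_mul _ _ _
    _ ≤ ‖x'‖ * ‖y'‖ - ‖x‖ * ‖y‖ := by gcongr
    _ = ‖x' * y'‖ - ‖x * y‖ := by rw [norm_mul, norm_mul]
    _ ≤ dist (x * y) (x' * y') := by
        rw [dist_comm, dist_eq_norm]
        exact norm_sub_norm_le _ _

theorem le_dist_mul_ringPoint {w : ℂ} {n i j : ℕ} {L : ℝ} (hq : 0 < q) (hρ : 0 ≤ ρ (n / q))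
    (hi : i < N (n / q)) (hj : j < N (n / q)) (hij : i ≠ j)
    (hN : N (n / q) * L ≤ 4 * (ρ (n / q) * ‖w‖)) :
    L ≤ dist (w * ringPoint ρ N q n i) (w * ringPoint ρ N q n j) := by
  have hNpos : (0 : ℝ) < N (n / q) := Nat.cast_pos.2 (i.zero_le.trans_lt hi)
  calc L ≤ 4 * (ρ (n / q) * ‖w‖) / N (n / q) := (le_div_iff₀' hNpos).2 hN
    _ = ‖w‖ * (4 * ρ (n / q) / N (n / q)) := by ring
    _ ≤ ‖w‖ * dist (ringPoint ρ N q n i) (ringPoint ρ N q n j) := by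
        gcongr
        exact le_dist_ringPoint hq hρ hi hj hij
    _ = _ := by rw [dist_eq_norm, dist_eq_norm, ← mul_sub, norm_mul]

theorem isSeparatedNet_ringPoint {μ : ℕ → ℂ} {S : Set ℂ} {r₀ L δ : ℝ} {K : ℕ} (hq : 0 < q)
    (hr₀ : 0 < r₀) (hL : 0 < L) (hμ : ∀ n, L / r₀ ≤ ‖μ n‖)
    (hgap : ∀ m n, m < n → ‖μ m‖ + L / r₀ ≤ ‖μ n‖) (hρ : Monotone ρ) (hρ₀ : ∀ k, r₀ ≤ ρ k)
    (hN : ∀ k, N k * L ≤ r₀ * ‖μ (k * q)‖)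
    (hS : ∀ a ∈ S, ∃ n < K * q, ∃ i < N (n / q), ‖μ n * (a - ringPoint ρ N q n i)‖ ≤ δ) :
    IsSeparatedNet ((Finset.range (K * q)).sigma fun n => Finset.range (N (n / q)))
      (fun p => μ p.1) (fun p => ringPoint ρ N q p.1 p.2) S L δ := by
  have hρ_nonneg : ∀ k, 0 ≤ ρ k := fun k => hr₀.le.trans (hρ₀ k)
  have hmono : Monotone fun n => ‖μ n‖ := monotone_nat_of_le_succ fun n => by
    linarith [hgap n _ n.lt_succ_self, div_pos hL hr₀]
  have hring : ∀ m n i j, m < n →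
      L ≤ dist (μ m * ringPoint ρ N q m i) (μ n * ringPoint ρ N q n j) := fun m n i j hmn => by
    have hM := mul_le_dist_mul_mul (r := r₀) (y := ringPoint ρ N q m i)
      (y' := ringPoint ρ N q n j) (div_pos hL hr₀).le (hgap m n hmn)
      (by rw [norm_ringPoint (hρ_nonneg _)]; exact hρ₀ _)
      (by rw [norm_ringPoint (hρ_nonneg _), norm_ringPoint (hρ_nonneg _)]
          exact hρ (Nat.div_le_div_right hmn.le))
    rwa [div_mul_cancel₀ _ hr₀.ne'] at hM
  refine ⟨?_, ?_, fun a ha => ?_⟩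
  · rintro ⟨n, i⟩ -
    rw [norm_mul, norm_ringPoint (hρ_nonneg _), ← div_mul_cancel₀ L hr₀.ne']
    exact mul_le_mul (hμ n) (hρ₀ _) hr₀.le (norm_nonneg _)
  · rintro ⟨m, i⟩ hmi ⟨n, j⟩ hnj hne
    simp only [Finset.coe_sigma, Set.mem_sigma_iff, Finset.coe_range, Set.mem_Iio] at hmi hnj
    rcases lt_trichotomy m n with h | rfl | h
    · exact hring m n i j h
    · have hν : r₀ * ‖μ (m / q * q)‖ ≤ ρ (m / q) * ‖μ m‖ :=
        mul_le_mul (hρ₀ _) (hmono (Nat.div_mul_le_self m q)) (norm_nonneg _) (hρ_nonneg _)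
      have hν_nonneg : 0 ≤ r₀ * ‖μ (m / q * q)‖ := by positivity
      exact le_dist_mul_ringPoint hq (hρ_nonneg _) hmi.2 hnj.2 (by simpa using hne)
        (by linarith [hN (m / q)])
    · rw [dist_comm]
      exact hring n m j i h
  · obtain ⟨n, hn, i, hi, hle⟩ := hS a ha
    exact ⟨⟨n, i⟩, by simp [hn, hi], hle⟩

theorem exists_norm_mul_sub_ringPoint_le {μ : ℕ → ℂ} (hμ : Monotone fun n => ‖μ n‖)
    {a : ℂ} {k : ℕ} {r₀ R₀ L δ : ℝ} (hq : 0 < q) (hr₀ : 0 < r₀) (hN₀ : 0 < N k)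
    (hN : r₀ * ‖μ (k * q)‖ ≤ 2 * (N k * L)) (hqδ : 16 * π * R₀ * L ≤ q * (r₀ * δ))
    (hdouble : ‖μ ((k + 1) * q)‖ ≤ 2 * ‖μ (k * q)‖)
    (hstep : ‖μ ((k + 1) * q)‖ * (ρ (k + 1) - ρ k) ≤ δ / 2)
    (ha : ‖a‖ ∈ Set.Icc (ρ k) (ρ (k + 1))) (haR : ‖a‖ ≤ R₀) :
    ∃ n i, n / q = k ∧ i < N k ∧ ‖μ n * (a - ringPoint ρ N q n i)‖ ≤ δ := by
  obtain ⟨n, i, hnk, hi, hle⟩ := exists_norm_sub_ringPoint_le hq hN₀ ha.1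
  have hn : ‖μ n‖ ≤ ‖μ ((k + 1) * q)‖ :=
    hμ (Nat.lt_mul_of_div_lt (by omega) hq).le
  have hradial : ‖μ ((k + 1) * q)‖ * (‖a‖ - ρ k) ≤ δ / 2 :=
    le_trans (by gcongr; exact ha.2) hstep
  have hangular : ‖μ ((k + 1) * q)‖ * (2 * π * ‖a‖ / (q * N k)) ≤ δ / 2 := by
    calc ‖μ ((k + 1) * q)‖ * (2 * π * ‖a‖ / (q * N k))
        ≤ 2 * ‖μ (k * q)‖ * (2 * π * R₀ / (q * N k)) := by gcongr
      _ = r₀ * ‖μ (k * q)‖ * (4 * π * R₀ / (r₀ * q * N k)) := by field_simp; ring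
      _ ≤ 2 * (N k * L) * (4 * π * R₀ / (r₀ * q * N k)) := by
          have : 0 ≤ R₀ := (norm_nonneg a).trans haR
          gcongr
      _ = 16 * π * R₀ * L / (q * (r₀ * 2)) := by field_simp; ring
      _ ≤ δ / 2 := by
          rw [div_le_div_iff₀ (by positivity) two_pos]
          linarith
  refine ⟨n, i, hnk, hi, ?_⟩
  calc ‖μ n * (a - ringPoint ρ N q n i)‖ = ‖μ n‖ * ‖a - ringPoint ρ N q n i‖ := norm_mul _ _
    _ ≤ ‖μ ((k + 1) * q)‖ * (‖a‖ - ρ k + 2 * π * ‖a‖ / (q * N k)) := by gcongr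
    _ ≤ δ := by linarith

theorem le_two_mul_floor_div_mul {x y : ℝ} (hy : 0 < y) (hxy : y ≤ x) :
    x ≤ 2 * (⌊x / y⌋₊ * y) := by
  have hfloor : (1 : ℝ) ≤ ⌊x / y⌋₊ := by exact_mod_cast Nat.floor_pos.2 ((one_le_div hy).2 hxy)
  rw [← mul_assoc, ← div_le_iff₀ hy]
  linarith [Nat.lt_floor_add_one (x / y)]

theorem exists_isSeparatedNet_of_not_summable {μ : ℕ → ℂ} {r₀ R₀ L δ : ℝ} (hr₀ : 0 < r₀)
    (hL : 0 < L) (hδ : 0 < δ) (hμ : ∀ n, L / r₀ ≤ ‖μ n‖)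
    (hgap : ∀ m n, m < n → ‖μ m‖ + L / r₀ ≤ ‖μ n‖) (hsum : ¬Summable fun n => 1 / ‖μ n‖) :
    ∃ (P : Finset (Σ _ : ℕ, ℕ)) (b : (Σ _ : ℕ, ℕ) → ℂ),
      IsSeparatedNet P (fun p => μ p.1) b {a | ‖a‖ ∈ Set.Ioc r₀ R₀} L δ := by
  have hpos : ∀ n, 0 < ‖μ n‖ := fun n => (div_pos hL hr₀).trans_le (hμ n)
  have hmono : Monotone fun n => ‖μ n‖ := monotone_nat_of_le_succ fun n => by
    linarith [hgap n _ n.lt_succ_self, div_pos hL hr₀]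
  have hL_le : ∀ k, L ≤ r₀ * ‖μ k‖ := fun k => (div_le_iff₀' hr₀).1 (hμ k)
  obtain ⟨q, hqδ⟩ := exists_nat_gt (max 0 (16 * π * R₀ * L / (r₀ * δ)))
  have hq : 0 < q := Nat.cast_pos.1 ((le_max_left _ _).trans_lt hqδ)
  obtain ⟨ρ, hρ₀, hρ_mono, hρ_lim, hρ_step⟩ :=
    exists_radii_of_not_summable_one_div hpos hmono hsum hq (half_pos hδ) r₀
  obtain ⟨K, hK⟩ := (hρ_lim.eventually_ge_atTop R₀).exists
  refine ⟨_, _, isSeparatedNet_ringPoint (K := K) (N := fun k => ⌊r₀ * ‖μ (k * q)‖ / L⌋₊) hq hr₀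
    hL hμ hgap hρ_mono (fun k => hρ₀ ▸ hρ_mono k.zero_le)
    (fun k => (le_div_iff₀ hL).1 (Nat.floor_le (by positivity))) fun a ⟨hra, haR⟩ => ?_⟩
  obtain ⟨k, hka, hkK, hak⟩ : ∃ k, ρ k < ‖a‖ ∧ k < K ∧ ‖a‖ ≤ ρ (k + 1) := by
    have hcover := hρ_mono.biUnion_Ico_Ioc_map_succ 0 K
    rw [hρ₀] at hcover
    simpa using hcover.ge ⟨hra, haR.trans hK⟩
  obtain ⟨hdouble, hstep⟩ := hρ_step k (hka.trans_le hak)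
  obtain ⟨n, i, hnk, hi, hle⟩ := exists_norm_mul_sub_ringPoint_le
    (N := fun k => ⌊r₀ * ‖μ (k * q)‖ / L⌋₊) hmono hq hr₀
    (Nat.floor_pos.2 ((one_le_div hL).2 (hL_le (k * q)))) (le_two_mul_floor_div_mul hL (hL_le _))
    ((div_le_iff₀ (by positivity)).1 ((le_max_right _ _).trans hqδ.le))
    hdouble hstep ⟨hka.le, hak⟩ haR
  exact ⟨n, Nat.lt_mul_of_div_lt (hnk ▸ hkK) hq, i, hnk ▸ hi, hle⟩

theorem ConditionSigma.exists_isSeparatedNet_annulus {l : ℕ → ℂ} (hl : ConditionSigma l)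
    {r₀ R₀ L δ : ℝ} (hr₀ : 0 < r₀) (hL : 0 < L) (hδ : 0 < δ) :
    ∃ (P : Finset (Σ _ : ℕ, ℕ)) (n : (Σ _ : ℕ, ℕ) → ℕ) (b : (Σ _ : ℕ, ℕ) → ℂ),
      IsSeparatedNet P (fun p => l (n p)) b {a | ‖a‖ ∈ Set.Ioc r₀ R₀} L δ := by
  obtain ⟨φ, hφ, hgap, hsum⟩ := hl.exists_subsequence (div_pos hL hr₀)
  obtain ⟨P, b, hP⟩ := exists_isSeparatedNet_of_not_summable hr₀ hL hδ hφ hgap hsum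
  exact ⟨P, fun p => φ p.1, b, hP⟩

theorem ConditionSigma.exists_isSeparatedNet {l : ℕ → ℂ} (hl : ConditionSigma l) {S : Set ℂ}
    (hS : IsCompact S) (h0 : 0 ∉ S) {L δ : ℝ} (hL : 0 < L) (hδ : 0 < δ) :
    ∃ (P : Finset (Σ _ : ℕ, ℕ)) (n : (Σ _ : ℕ, ℕ) → ℕ) (b : (Σ _ : ℕ, ℕ) → ℂ),
      IsSeparatedNet P (fun p => l (n p)) b S L δ := by
  obtain ⟨r₀, hr₀, hball⟩ := Metric.nhds_basis_closedBall.mem_iff.1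
    (hS.isClosed.isOpen_compl.mem_nhds h0)
  obtain ⟨R₀, hR₀⟩ := hS.isBounded.exists_norm_le
  obtain ⟨P, n, b, hP⟩ := hl.exists_isSeparatedNet_annulus (R₀ := R₀) hr₀ hL hδ
  refine ⟨P, n, b, hP.mono fun a ha => ⟨not_le.1 fun hle => hball ?_ ha, hR₀ a ha⟩⟩
  rwa [mem_closedBall_zero_iff]

end SeparatedNet

section CommonHittingSet

variable {ι A X Y : Type*}

/-- The set of `x` such that, for every parameter `a ∈ S`, some `T i a` maps `x` into `U`. Common
hypercyclicity over `S` means lying in these sets for all nonempty open `U`. -/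
def commonHittingSet (T : ι → A → X → Y) (S : Set A) (U : Set Y) : Set X :=
  {x | ∀ a ∈ S, ∃ i, T i a x ∈ U}

theorem biInter_setOf_dense_range_eq_biInter_commonHittingSet [TopologicalSpace Y]
    (T : ι → A → X → Y) {S : Set A} {κ : Type*} {K : κ → Set A} (hK : ⋃ k, K k = S)
    {B : Set (Set Y)} (hB : TopologicalSpace.IsTopologicalBasis B) (hne : ∀ U ∈ B, U.Nonempty) :
    (⋂ a ∈ S, {x | Dense (Set.range fun i => T i a x)}) =
      ⋂ k, ⋂ U ∈ B, commonHittingSet T (K k) U := by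
  ext x
  have hdense : ∀ a, Dense (Set.range fun i => T i a x) ↔ ∀ U ∈ B, ∃ i, T i a x ∈ U := fun a => by
    rw [hB.dense_iff]
    exact forall₂_congr fun U hU => by
      simp [hne U hU, Set.inter_nonempty, and_comm]
  simp only [← hK, commonHittingSet, Set.mem_iInter, Set.mem_ofPred_eq, hdense, Set.mem_iUnion,
    forall_exists_index]
  exact ⟨fun h k U hU a ha => h a k ha U hU, fun h a k ha U hU => h k U hU a ha⟩

variable [TopologicalSpace A] [TopologicalSpace X] [TopologicalSpace Y] {T : ι → A → X → Y}

theorem isOpen_commonHittingSet (hT : ∀ i, Continuous fun p : X × A => T i p.2 p.1) {S : Set A}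
    (hS : IsCompact S) {U : Set Y} (hU : IsOpen U) : IsOpen (commonHittingSet T S U) := by
  rw [isOpen_iff_mem_nhds]
  intro x hx
  refine hS.eventually_forall_of_forall_eventually
    (P := fun x a => ∃ i, T i a x ∈ U) fun a ha => ?_
  obtain ⟨i, hi⟩ := hx a ha
  filter_upwards [(hU.preimage (hT i)).mem_nhds hi] with p hp using ⟨i, hp⟩

theorem isGδ_and_dense_of_dense_commonHittingSet [BaireSpace X] [SecondCountableTopology Y]
    (hT : ∀ i, Continuous fun p : X × A => T i p.2 p.1) {S : Set A} (hS : IsSigmaCompact S)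
    (hdense : ∀ K ⊆ S, IsCompact K → ∀ U, IsOpen U → U.Nonempty →
      Dense (commonHittingSet T K U)) :
    IsGδ (⋂ a ∈ S, {x | Dense (Set.range fun i => T i a x)}) ∧
      Dense (⋂ a ∈ S, {x | Dense (Set.range fun i => T i a x)}) := by
  obtain ⟨K, hK, hKS⟩ := hS
  have hB := TopologicalSpace.isBasis_countableBasis Y
  have hcount := TopologicalSpace.countable_countableBasis Y
  have hne : ∀ U ∈ TopologicalSpace.countableBasis Y, U.Nonempty := fun U hU =>
    TopologicalSpace.nonempty_of_mem_countableBasis hU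
  have hopen : ∀ k, ∀ U ∈ TopologicalSpace.countableBasis Y,
      IsOpen (commonHittingSet T (K k) U) := fun k U hU =>
    isOpen_commonHittingSet hT (hK k) (hB.isOpen hU)
  have hGδ : ∀ k, IsGδ (⋂ U ∈ TopologicalSpace.countableBasis Y, commonHittingSet T (K k) U) :=
    fun k => .biInter_of_isOpen hcount (hopen k)
  rw [biInter_setOf_dense_range_eq_biInter_commonHittingSet T hKS hB hne]
  exact ⟨.iInter hGδ, dense_iInter_of_Gδ hGδ fun k =>
    dense_biInter_of_isOpen (hopen k) hcount fun U hU =>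
      hdense _ (hKS ▸ Set.subset_iUnion K k) (hK k) U (hB.isOpen hU) (hne U hU)⟩

end CommonHittingSet

section EntireFunctions

theorem isClosed_entireFunctions : IsClosed (entireFunctions : Set C(ℂ, ℂ)) := by
  refine isClosed_of_closure_subset fun f hf => ?_
  obtain ⟨u, hu, hlim⟩ := mem_closure_iff_seq_limit.1 hf
  have hlocal := tendstoLocallyUniformlyOn_univ.2
    (ContinuousMap.tendsto_iff_tendstoLocallyUniformly.1 hlim)
  exact differentiableOn_univ.1 (hlocal.differentiableOn
    (.of_forall fun n => (hu n : Differentiable ℂ (u n)).differentiableOn) isOpen_univ)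

instance : BaireSpace entireFunctions :=
  have : CompleteSpace entireFunctions := isClosed_entireFunctions.completeSpace_coe
  have : (uniformity entireFunctions).IsCountablyGenerated :=
    Filter.comap.isCountablyGenerated (uniformity C(ℂ, ℂ)) _
  inferInstance

theorem continuous_translation_uncurry :
    Continuous fun p : entireFunctions × ℂ => translation p.2 p.1 := by
  have hshift : Continuous fun a : ℂ => (⟨fun z => z + a, by fun_prop⟩ : C(ℂ, ℂ)) :=
    ContinuousMap.continuous_of_continuous_uncurry _ (by
      simp only [Function.uncurry_def, ContinuousMap.coe_mk]
      fun_prop)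
  exact Continuous.subtype_mk (ContinuousMap.continuous_comp'.comp
    ((hshift.comp continuous_snd).prodMk (continuous_subtype_val.comp continuous_fst))) _

theorem exists_forall_dist_lt_imp_mem {E F : Type*} [PseudoMetricSpace E] [PseudoMetricSpace F]
    {U : Set C(E, F)} (hU : IsOpen U) {f : C(E, F)} (hf : f ∈ U) (x : E) :
    ∃ R > 0, ∃ ε > 0, ∀ h : C(E, F),
      (∀ y ∈ Metric.closedBall x R, dist (h y) (f y) < ε) → h ∈ U := by
  have hbasis := nhds_basis_uniformity'
    (Metric.uniformity_basis_dist.compactConvergenceUniformity (α := E) (β := F)) (x := f)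
  obtain ⟨⟨K, ε⟩, ⟨hK, hε⟩, hKε⟩ := hbasis.mem_iff.1 (hU.mem_nhds hf)
  obtain ⟨R, hR, hKR⟩ := hK.isBounded.subset_closedBall_lt 0 x
  exact ⟨R, hR, ε, hε, fun h hh => hKε fun y hy =>
    (dist_comm (f y) (h y)).trans_lt (hh y (hKR hy))⟩

theorem exists_forall_norm_sub_translation_lt_imp_mem {U : Set C(ℂ, ℂ)} (hU : IsOpen U)
    {f : entireFunctions} (hf : (f : C(ℂ, ℂ)) ∈ U) :
    ∃ R, ∃ ε > 0, ∃ δ > 0, ∀ (h : C(ℂ, ℂ)) (d : ℂ), ‖d‖ ≤ δ →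
      (∀ z ∈ Metric.closedBall 0 R, ‖h z - (f : C(ℂ, ℂ)) (z + d)‖ < ε) → h ∈ U := by
  have hcont : Continuous fun p : C(ℂ, ℂ) × ℂ => p.1 + (translation p.2 f : C(ℂ, ℂ)) :=
    continuous_fst.add (continuous_subtype_val.comp (continuous_translation_uncurry.comp
      (continuous_const.prodMk continuous_snd)))
  have hzero : (0 : C(ℂ, ℂ)) + (translation 0 f : C(ℂ, ℂ)) = f := by ext z; simp
  obtain ⟨V, D, hV, hD, hV0, hD0, hVD⟩ :=
    isOpen_prod_iff.1 (hU.preimage hcont) 0 0 (by rwa [Set.mem_preimage, hzero])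
  obtain ⟨R, -, ε, hε, hRV⟩ := exists_forall_dist_lt_imp_mem hV hV0 (0 : ℂ)
  obtain ⟨δ, hδ, hδD⟩ := Metric.nhds_basis_closedBall.mem_iff.1 (hD.mem_nhds hD0)
  refine ⟨R, ε, hε, δ, hδ, fun h d hd hh => ?_⟩
  have hsum : h - (translation d f : C(ℂ, ℂ)) + (translation d f : C(ℂ, ℂ)) ∈ U :=
    hVD (Set.mk_mem_prod (hRV _ fun z hz => by simpa using hh z hz) (hδD (by simpa using hd)))
  rwa [sub_add_cancel] at hsum

end EntireFunctions

section Density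

variable {ι : Type*} {P : Finset ι} {ν b : ι → ℂ} {S : Set ℂ} {L δ ρ : ℝ}

theorem IsSeparatedNet.exists_entireFunctions_near (h : IsSeparatedNet P ν b S L δ) (hρ : 0 ≤ ρ)
    (hρL : 2 * ρ < L) (g f : entireFunctions) {ε : ℝ} (hε : 0 < ε) :
    ∃ F : entireFunctions,
      (∀ z ∈ Metric.closedBall 0 ρ, ‖(F : C(ℂ, ℂ)) z - (g : C(ℂ, ℂ)) z‖ < ε) ∧
      ∀ p ∈ P, ∀ z ∈ Metric.closedBall 0 ρ,
        ‖(F : C(ℂ, ℂ)) (z + ν p * b p) - (f : C(ℂ, ℂ)) z‖ < ε := by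
  let c : Option ι → ℂ := fun o => o.elim 0 fun p => ν p * b p
  let G : Option ι → entireFunctions := fun o => o.elim g fun p => translation (-(ν p * b p)) f
  have hc : (Finset.insertNone P : Set (Option ι)).Pairwise fun i j =>
      ρ + ρ < dist (c i) (c j) := by
    rintro (_ | p) hp (_ | p') hp' hne
    · exact absurd rfl hne
    · have := h.le_norm p' (Finset.some_mem_insertNone.1 hp')
      simp only [c, Option.elim, dist_zero_left]
      linarith
    · have := h.le_norm p (Finset.some_mem_insertNone.1 hp)
      simp only [c, Option.elim, dist_zero_right]
      linarith
    · have := h.pairwise_le_dist (Finset.some_mem_insertNone.1 hp)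
        (Finset.some_mem_insertNone.1 hp') (mt (congrArg some) hne)
      simp only [c, Option.elim]
      linarith
  obtain ⟨F, hF⟩ := exists_entireFunctions_near_on_closedBalls (fun _ _ => hρ) hc G hε
  refine ⟨F, hF none Finset.none_mem_insertNone, fun p hp z hz => ?_⟩
  have hFp := hF (some p) (Finset.some_mem_insertNone.2 hp) (z + ν p * b p)
    (by simpa [c] using hz)
  simpa [G] using hFp

theorem dense_commonHittingSet_translation {l : ℕ → ℂ} (hl : ConditionSigma l)
    (hS : IsCompact S) (h0 : 0 ∉ S) {U : Set entireFunctions} (hU : IsOpen U)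
    (hne : U.Nonempty) : Dense (commonHittingSet (fun n a => translation (l n * a)) S U) := by
  rw [dense_iff_inter_open]
  rintro _ hVo ⟨g, hg⟩
  obtain ⟨f, hf⟩ := hne
  obtain ⟨V, hV, rfl⟩ := isOpen_induced_iff.1 hVo
  obtain ⟨W, hW, rfl⟩ := isOpen_induced_iff.1 hU
  obtain ⟨R₁, hR₁, ε₁, hε₁, hgV⟩ := exists_forall_dist_lt_imp_mem hV hg (0 : ℂ)
  obtain ⟨R₂, ε₂, hε₂, δ, hδ, hfW⟩ := exists_forall_norm_sub_translation_lt_imp_mem hW hf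
  set ρ := max R₁ (R₂ + δ)
  have hρ : 0 < ρ := hR₁.trans_le (le_max_left _ _)
  obtain ⟨P, n, b, hP⟩ := hl.exists_isSeparatedNet hS h0 (L := 2 * ρ + 1) (by positivity) hδ
  obtain ⟨F, hFg, hFf⟩ :=
    hP.exists_entireFunctions_near hρ.le (lt_add_one _) g f (lt_min hε₁ hε₂)
  refine ⟨F, hgV F fun z hz => ?_, fun a ha => ?_⟩
  · rw [dist_eq_norm]
    exact (hFg z (Metric.closedBall_subset_closedBall (le_max_left _ _) hz)).trans_le
      (min_le_left _ _)
  · obtain ⟨p, hp, hd⟩ := hP.exists_norm_mul_sub_le a ha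
    refine ⟨n p, hfW _ _ hd fun z hz => ?_⟩
    have hzd : z + l (n p) * (a - b p) ∈ Metric.closedBall 0 ρ := by
      rw [mem_closedBall_zero_iff] at hz ⊢
      exact (norm_add_le_of_le hz hd).trans (le_max_right _ _)
    have hshift : z + l (n p) * a = z + l (n p) * (a - b p) + l (n p) * b p := by ring
    rw [translation_apply, hshift]
    exact (hFf p hp _ hzd).trans_le (min_le_right _ _)

end Density

theorem proposition2p1_general {l : ℕ → ℂ} (hl : ConditionSigma l) {S : Set ℂ}
    (hS : IsSigmaCompact S) (h0 : 0 ∉ S) :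
    IsGδ (⋂ a ∈ S, hypercyclicVectors fun n => translation (l n * a)) ∧
      Dense (⋂ a ∈ S, hypercyclicVectors fun n => translation (l n * a)) :=
  have : SecondCountableTopology entireFunctions :=
    TopologicalSpace.Subtype.secondCountableTopology _
  isGδ_and_dense_of_dense_commonHittingSet
    (T := fun n a (f : entireFunctions) => translation (l n * a) f)
    (fun _ => continuous_translation_uncurry.comp
      (continuous_fst.prodMk (continuous_const.mul continuous_snd)))
    hS fun _ hK hKc _ hU hne =>
      dense_commonHittingSet_translation hl hKc (fun h => h0 (hK h)) hU hne

theorem isCompact_sector (r₀ R₀ θ₀ θT : ℝ) : IsCompact (sector r₀ R₀ θ₀ θT) := by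
  have himage : sector r₀ R₀ θ₀ θT =
      (fun p : ℝ × ℝ => (p.1 : ℂ) * Complex.exp (2 * Real.pi * Complex.I * p.2)) ''
        (Set.Icc r₀ R₀ ×ˢ Set.Icc θ₀ θT) := by
    ext a
    simp only [sector, Set.mem_ofPred_eq, Set.mem_image, Set.mem_prod, Prod.exists]
    grind
  rw [himage]
  exact (isCompact_Icc.prod isCompact_Icc).image (by fun_prop)

theorem zero_notMem_sector {r₀ : ℝ} (hr₀ : 0 < r₀) (R₀ θ₀ θT : ℝ) :
    0 ∉ sector r₀ R₀ θ₀ θT := by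
  rintro ⟨r, hr, t, -, h⟩
  exact mul_ne_zero (Complex.ofReal_ne_zero.2 (hr₀.trans_le hr.1).ne') (Complex.exp_ne_zero _)
    h.symm

theorem proposition2p1 (l : ℕ → ℂ) (hl0 : ∀ n, l n ≠ 0)
    (hlim : Tendsto (fun n => ‖l n‖) atTop atTop) (hl : ConditionSigma l)
    (r₀ R₀ θ₀ θT : ℝ) (hr₀ : 0 < r₀) (hr₀1 : r₀ < 1) (hR₀ : 1 < R₀)
    (hθ₀ : 0 ≤ θ₀) (hθ : θ₀ < θT) (hθT : θT ≤ 1) (hdiff : θT - θ₀ = 1 / 4) :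
    IsGδ (⋂ a ∈ sector r₀ R₀ θ₀ θT, hypercyclicVectors fun n => translation (l n * a)) ∧
      Dense (⋂ a ∈ sector r₀ R₀ θ₀ θT, hypercyclicVectors fun n => translation (l n * a)) :=
  proposition2p1_general hl (isCompact_sector r₀ R₀ θ₀ θT).isSigmaCompact
    (zero_notMem_sector hr₀ R₀ θ₀ θT)
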